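/- **Setting.** Let $m>1$, $n\ge 0$. Let $M$ and $F$ be smooth manifolds with $\dim M=m$ and $\dim F=m+n$, let $\kappa\colon F\to M$ be a fibred manifold (a smooth surjective submersion, for example a fibre bundle), $\eta$ a volume form on $M$, and $\Omega$ a closed $(m+1)$-form on $F$. Write $\mathrm V_y(\kappa)=\ker \mathrm T_y\kappa$ for the vertical subspace at $y\in F$ and assume that $\Omega$ vanishes whenever three of its arguments are vertical. Let $\nabla$ be an Ehresmann connection in $\kappa$, that is, a smooth family of linear maps $\nabla(y)\colon \mathrm T_{\kappa(y)}M\to \mathrm T_yF$ with $\mathrm T_y\kappa\circ\nabla(y)=\mathrm{Id}$; put $\mathrm H_y(\nabla)=\operatorname{Im}\nabla(y)$, so that $\mathrm T_yF=\mathrm H_y(\nabla)\oplus\mathrm V_y(\kappa)$, and let $(\mathrm T_y\kappa_{\mathrm H(\nabla)})^{-1}\colon \mathrm T_{\kappa(y)}M\to\mathrm H_y(\nabla)$ be the horizontal lift, the inverse of $\mathrm T_y\kappa|_{\mathrm H_y(\nabla)}$. Let $\mathcal Y^\nabla_\eta(y)\in\Lambda^m\mathrm T_yF$ be the image under $\Lambda^m\nabla(y)$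 of the unique $\mathcal Z\in\Lambda^m\mathrm T_{\kappa(y)}M$ with $\eta(\mathcal Z)=1$, and let $\gamma^\nabla_\eta(y)=i(\mathcal Y^\nabla_\eta(y))\Omega(y)\in \mathrm T_y^*F$, where $i(w_1\wedge\dots\wedge w_m)\Omega=\Omega(w_1,\dots,w_m,\cdot)$. Let $C\hookrightarrow F$ be a submanifold and $y\in C$. For a linear map $\mathbf h_y\colon \mathrm T_{\kappa(y)}M\to \mathrm T_yC\subseteq\mathrm T_yF$ let $(\mathbf h_y)^H_\nabla$ and $(\mathbf h_y)^V_\nabla$ be its horizontal and vertical parts, and $\widetilde{(\mathbf h_y)^V_\nabla}=(\mathbf h_y)^V_\nabla\circ \mathrm T_y\kappa$. For an endomorphism $A$ of $\mathrm T_yF$ put $i(A^t)(w_1\wedge\dots\wedge w_m)=\sum_\alpha w_1\wedge\dots\wedge A w_\alpha\wedge\dots\wedge w_m$, extended linearly. Define the linear map $$\flat^\nabla_\Omega(y)(\mathbf h_y)=\Big((\mathbf h_y)^H_\nabla,\ \big[i\big(i([\widetilde{(\mathbf h_y)^V_\nabla}]^t)\mathcal Y^\nabla_\eta(y)\big)\Omega(y)\big]\big|_{\mathrm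 V_y(\kappa)}\Big)\in (\mathrm T^*_{\kappa(y)}M\otimes \mathrm H_y(\nabla))\times \mathrm V_y^*(\kappa).$$ Let $\mathrm V_y(\kappa)^0\subseteq \mathrm T_y^*F$ be the annihilator of $\mathrm V_y(\kappa)$, and pair $\mathrm T_{\kappa(y)}M\otimes\mathrm V_y(\kappa)^0$ with $\mathrm T^*_{\kappa(y)}M\otimes\mathrm H_y(\nabla)\cong \mathrm{Lin}(\mathrm T_{\kappa(y)}M,\mathrm H_y(\nabla))$ by $(e\otimes\beta)(g)=\beta(g(e))$. Let $(\mathrm T_y^\perp C)^\nabla_\Omega=(\operatorname{Im}\flat^\nabla_\Omega(y))^0$, the subspace of all $(\mathbf h_y^*,Z_y)\in(\mathrm T_{\kappa(y)}M\otimes\mathrm V_y(\kappa)^0)\times\mathrm V_y(\kappa)$ with $\mathbf h^*_y(g)+\xi(Z_y)=0$ for every $(g,\xi)\in\operatorname{Im}\flat^\nabla_\Omega(y)$. **Theorem.** The following are equivalent. 1. There exists a linear map $\mathbf h_y\colon \mathrm T_{\kappa(y)}M\to\mathrm T_yC$ such that $$(\mathbf h_y)^H_\nabla=(\mathrm T_y\kappa_{\mathrm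 H(\nabla)})^{-1},\qquad \big[i\big(i([\widetilde{(\mathbf h_y)^V_\nabla}]^t)\mathcal Y^\nabla_\eta(y)\big)\Omega(y)\big]\big|_{\mathrm V_y(\kappa)}=-\gamma^\nabla_\eta(y)\big|_{\mathrm V_y(\kappa)}.$$ 2. There exists a linear map $\mathbf h_y\colon \mathrm T_{\kappa(y)}M\to\mathrm T_yC$ solving the field equations at $y$, that is, $\mathrm T_y\kappa\circ\mathbf h_y=\mathrm{Id}$ and $\Omega(y)(\mathbf h_y(X_1),\dots,\mathbf h_y(X_m),Y)=0$ for all $X_1,\dots,X_m\in\mathrm T_{\kappa(y)}M$ and $Y\in\mathrm T_yF$. 3. $\mathbf h_y^*\big((\mathrm T_y\kappa_{\mathrm H(\nabla)})^{-1}\big)-\gamma^\nabla_\eta(y)(Z_y)=0$ for every $(\mathbf h_y^*,Z_y)\in(\mathrm T_y^\perp C)^\nabla_\Omega$. -/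

import Mathlib

open Set Module
open scoped Manifold ContDiff TensorProduct

noncomputable section

/-! ## Linear algebra -/

namespace PreMultisymplectic

section MultiVectors

variable {W E : Type*} [AddCommGroup W] [Module ℝ W] [AddCommGroup E] [Module ℝ E] {m : ℕ}

/-- The value `η(Z)` of an alternating `m`-form on an `m`-vector. -/
def evalMV (η : E [⋀^Fin m]→ₗ[ℝ] ℝ) : ⋀[ℝ]^m E →ₗ[ℝ] ℝ :=
  exteriorPower.alternatingMapLinearEquiv η

/-- The interior product `i(Y)Ω` of an `(m+1)`-form with an `m`-vector, a linear form on `W`.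
On decomposable `m`-vectors it is `w ↦ Ω(w₁, …, wₘ, w)`, see `contract_ιMulti`. -/
def contract (Ω : W [⋀^Fin (m + 1)]→ₗ[ℝ] ℝ) : ⋀[ℝ]^m W →ₗ[ℝ] Dual ℝ W :=
  (-1 : ℝ) ^ m • ((exteriorPower.alternatingMapLinearEquiv (R := ℝ) (M := W) (n := m)
    (N := ℝ)).toLinearMap ∘ₗ Ω.curryLeft).flip

theorem contract_ιMulti (Ω : W [⋀^Fin (m + 1)]→ₗ[ℝ] ℝ) (v : Fin m → W) (w : W) :
    contract Ω (exteriorPower.ιMulti ℝ m v) w = Ω (Fin.snoc v w) := by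
  have h : (Fin.snoc v w : Fin (m + 1) → W) = Matrix.vecCons w v ∘ (finRotate (m + 1)) := by
    funext i
    refine Fin.lastCases ?_ (fun i => ?_) i
    · simp
    · simp [Matrix.vecCons]
  rw [h, AlternatingMap.map_perm, sign_finRotate]
  simp [contract, Units.smul_def]

/-- The alternating map `v ↦ ∑_α v₁ ∧ … ∧ A v_α ∧ … ∧ vₘ`. -/
def derivAlt (A : W →ₗ[ℝ] W) : W [⋀^Fin m]→ₗ[ℝ] ⋀[ℝ]^m W where
  toMultilinearMap := ∑ i : Fin m,
    (exteriorPower.ιMulti ℝ m (M := W)).toMultilinearMap.compLinearMap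
      (fun j => if j = i then A else LinearMap.id)
  map_eq_zero_of_eq' := by
    intro v a b hv hab
    have key : ∀ i : Fin m, (fun j => (if j = i then A else LinearMap.id : W →ₗ[ℝ] W) (v j))
        = Function.update v i (A (v i)) := by
      intro i; funext j
      by_cases h : j = i
      · subst h; simp
      · simp [h]
    simp only [MultilinearMap.toFun_eq_coe, sum_apply,
      MultilinearMap.compLinearMap_apply, AlternatingMap.coe_multilinearMap, key]
    rw [← Finset.sum_subset (Finset.subset_univ {a, b}), Finset.sum_pair hab]
    · have : Function.update v a (A (v a)) =
          Function.update v b (A (v b)) ∘ Equiv.swap a b := by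
        funext j
        by_cases hja : j = a
        · subst hja; simp [hv]
        · by_cases hjb : j = b
          · subst hjb; simp [hv, hab, Ne.symm hab]
          · simp [hja, hjb, Equiv.swap_apply_of_ne_of_ne]
      rw [this, AlternatingMap.map_swap _ _ hab, neg_add_cancel]
    · intro i _ hi
      simp only [Finset.mem_insert, Finset.mem_singleton, not_or] at hi
      refine AlternatingMap.map_eq_zero_of_eq _ _ ?_ hab
      rw [Function.update_of_ne (Ne.symm hi.1), Function.update_of_ne (Ne.symm hi.2), hv]

theorem derivAlt_apply (A : W →ₗ[ℝ] W) (v : Fin m → W) :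
    derivAlt A v = ∑ i, exteriorPower.ιMulti ℝ m (Function.update v i (A (v i))) := by
  have key : ∀ i : Fin m, (fun j => (if j = i then A else LinearMap.id : W →ₗ[ℝ] W) (v j))
      = Function.update v i (A (v i)) := by
    intro i; funext j
    by_cases h : j = i
    · subst h; simp
    · simp [h]
  change (∑ i : Fin m, (exteriorPower.ιMulti ℝ m (M := W)).toMultilinearMap.compLinearMap
      (fun j => if j = i then A else LinearMap.id)) v = _
  simp only [sum_apply,
      MultilinearMap.compLinearMap_apply, AlternatingMap.coe_multilinearMap, key]

/-- The interior product `A ↦ i(Aᵗ)Y` of endomorphisms `A` of `W` with `m`-vectors, namely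
the extension of `A` to `m`-vectors as a derivation:
`w₁ ∧ … ∧ wₘ ↦ ∑_α w₁ ∧ … ∧ A w_α ∧ … ∧ wₘ`, see `deriv_ιMulti`. -/
def deriv : (W →ₗ[ℝ] W) →ₗ[ℝ] ⋀[ℝ]^m W →ₗ[ℝ] ⋀[ℝ]^m W where
  toFun A := exteriorPower.alternatingMapLinearEquiv (derivAlt A)
  map_add' A B := by
    rw [← map_add]
    congr 1
    ext1 v
    simp only [AlternatingMap.add_apply, derivAlt_apply, LinearMap.add_apply,
      AlternatingMap.map_update_add, Finset.sum_add_distrib]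
  map_smul' c A := by
    rw [RingHom.id_apply, ← map_smul]
    congr 1
    ext1 v
    simp only [AlternatingMap.smul_apply, derivAlt_apply, LinearMap.smul_apply,
      AlternatingMap.map_update_smul, Finset.smul_sum]

theorem deriv_ιMulti (A : W →ₗ[ℝ] W) (v : Fin m → W) :
    deriv A (exteriorPower.ιMulti ℝ m v) =
      ∑ i, exteriorPower.ιMulti ℝ m (Function.update v i (A (v i))) := by
  simp [deriv, derivAlt_apply]

variable [FiniteDimensional ℝ E]

/-- The `m`-vector `Z` on an `m`-dimensional space with `η(Z) = 1`, where `η` is a volume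
element: see `evalMV_unitMV` and `unitMV_unique`. -/
def unitMV (hE : finrank ℝ E = m) (η : E [⋀^Fin m]→ₗ[ℝ] ℝ) : ⋀[ℝ]^m E :=
  (η (finBasisOfFinrankEq ℝ E hE))⁻¹ • exteriorPower.ιMulti ℝ m (finBasisOfFinrankEq ℝ E hE)

theorem evalMV_unitMV (hE : finrank ℝ E = m) {η : E [⋀^Fin m]→ₗ[ℝ] ℝ} (hη : η ≠ 0) :
    evalMV η (unitMV hE η) = 1 := by
  have h0 : η (finBasisOfFinrankEq ℝ E hE) ≠ 0 :=
    fun h => hη ((AlternatingMap.map_basis_eq_zero_iff _ η).1 h)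
  simp [evalMV, unitMV, h0]

theorem unitMV_unique (hE : finrank ℝ E = m) {η : E [⋀^Fin m]→ₗ[ℝ] ℝ} (hη : η ≠ 0)
    (Z : ⋀[ℝ]^m E) (hZ : evalMV η Z = 1) : Z = unitMV hE η := by
  have h1 : finrank ℝ (⋀[ℝ]^m E) = 1 := by rw [exteriorPower.finrank_eq, hE, Nat.choose_self]
  have hu := evalMV_unitMV hE hη
  have hne : unitMV hE η ≠ 0 := by
    intro h; rw [h, map_zero] at hu; exact zero_ne_one hu
  obtain ⟨c, rfl⟩ := (finrank_eq_one_iff_of_nonzero' _ hne).1 h1 Z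
  rw [map_smul, hu, smul_eq_mul, mul_one] at hZ
  rw [hZ, one_smul]

end MultiVectors

section Splitting

variable {W E C : Type*} [AddCommGroup W] [Module ℝ W] [AddCommGroup E] [Module ℝ E]
  [AddCommGroup C] [Module ℝ C]

/-- A section `s` of a surjective linear map `σ : W → E`, i.e. `σ ∘ s = id`. Its horizontal
subspace is `LinearMap.range s`; the vertical subspace is `LinearMap.ker σ`. -/
structure LinSection (σ : W →ₗ[ℝ] E) where
  lift : E →ₗ[ℝ] W
  comp_lift : ∀ e, σ (lift e) = e

variable {σ : W →ₗ[ℝ] E} (s : LinSection σ)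

namespace LinSection

/-- The horizontal subspace. -/
abbrev hor : Submodule ℝ W := LinearMap.range s.lift

/-- The projection of `W = H ⊕ V` onto the horizontal subspace. -/
def projH : W →ₗ[ℝ] s.hor := s.lift.rangeRestrict ∘ₗ σ

/-- The projection of `W = H ⊕ V` onto the vertical subspace. -/
def projV : W →ₗ[ℝ] LinearMap.ker σ :=
  LinearMap.codRestrict (LinearMap.ker σ) (LinearMap.id - s.lift ∘ₗ σ) (fun w => by
    simp [s.comp_lift])

theorem projH_add_projV (w : W) : (s.projH w : W) + (s.projV w : W) = w := by
  simp [projH, projV]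

/-- The restriction of `σ` to the horizontal subspace, an isomorphism onto `E`. -/
def horEquiv : s.hor ≃ₗ[ℝ] E where
  toLinearMap := σ ∘ₗ s.hor.subtype
  invFun := s.lift.rangeRestrict
  left_inv := by
    rintro ⟨_, e, rfl⟩
    ext
    simp [s.comp_lift]
  right_inv e := by simp [s.comp_lift]

/-- The horizontal lift `(σ|_H)⁻¹ : E → H`. -/
def horLift : E →ₗ[ℝ] s.hor := s.horEquiv.symm.toLinearMap

/-- The horizontal part `h^H : E → H` of `h : E → C`, where `ι : C → W` is the inclusion. -/
def partH (ι : C →ₗ[ℝ] W) : (E →ₗ[ℝ] C) →ₗ[ℝ] (E →ₗ[ℝ] s.hor) :=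
  LinearMap.compRight ℝ (s.projH ∘ₗ ι)

/-- The endomorphism `h^V ∘ σ` of `W`, where `h^V : E → V` is the vertical part of
`h : E → C` and `ι : C → W` is the inclusion. -/
def tildeV (ι : C →ₗ[ℝ] W) : (E →ₗ[ℝ] C) →ₗ[ℝ] (W →ₗ[ℝ] W) :=
  LinearMap.lcomp ℝ W σ ∘ₗ LinearMap.compRight ℝ ((LinearMap.ker σ).subtype ∘ₗ s.projV ∘ₗ ι)

theorem partH_apply (ι : C →ₗ[ℝ] W) (h : E →ₗ[ℝ] C) (e : E) :
    s.partH ι h e = s.projH (ι (h e)) := rfl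

theorem tildeV_apply (ι : C →ₗ[ℝ] W) (h : E →ₗ[ℝ] C) (w : W) :
    s.tildeV ι h w = (s.projV (ι (h (σ w))) : W) := rfl

/-- The natural pairing of `E ⊗ V⁰` with `E* ⊗ H = Lin(E, H)`, where `V⁰ ⊆ W*` is the
annihilator of the vertical subspace: `⟨e ⊗ β, g⟩ = β(g(e))`. -/
def pairH : E ⊗[ℝ] (LinearMap.ker σ).dualAnnihilator →ₗ[ℝ] Dual ℝ (E →ₗ[ℝ] s.hor) :=
  TensorProduct.lift (LinearMap.mk₂ ℝ
    (fun e β => (β : Dual ℝ W) ∘ₗ s.hor.subtype ∘ₗ LinearMap.applyₗ e)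
    (fun _ _ _ => by ext; simp) (fun _ _ _ => by ext; simp)
    (fun _ _ _ => by ext; simp) (fun _ _ _ => by ext; simp))

theorem pairH_tmul (e : E) (β : (LinearMap.ker σ).dualAnnihilator) (g : E →ₗ[ℝ] s.hor) :
    s.pairH (e ⊗ₜ β) g = (β : Dual ℝ W) (g e : W) := rfl

/-- The natural pairing of `(E ⊗ V⁰) × V` with `(E* ⊗ H) × V*`:
`⟨(h*, Z), (g, ξ)⟩ = ⟨h*, g⟩ + ξ(Z)`. -/
def pairing : (E ⊗[ℝ] (LinearMap.ker σ).dualAnnihilator) × LinearMap.ker σ →ₗ[ℝ]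
    Dual ℝ ((E →ₗ[ℝ] s.hor) × Dual ℝ (LinearMap.ker σ)) :=
  ((LinearMap.fst ℝ (E →ₗ[ℝ] s.hor) (Dual ℝ (LinearMap.ker σ))).dualMap ∘ₗ s.pairH).coprod
    ((LinearMap.snd ℝ (E →ₗ[ℝ] s.hor) (Dual ℝ (LinearMap.ker σ))).dualMap ∘ₗ
      Dual.eval ℝ (LinearMap.ker σ))

theorem pairing_apply (p : (E ⊗[ℝ] (LinearMap.ker σ).dualAnnihilator) × LinearMap.ker σ)
    (q : (E →ₗ[ℝ] s.hor) × Dual ℝ (LinearMap.ker σ)) :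
    s.pairing p q = s.pairH p.1 q.1 + q.2 p.2 := rfl

variable [FiniteDimensional ℝ E] {m : ℕ} (hE : finrank ℝ E = m) (η : E [⋀^Fin m]→ₗ[ℝ] ℝ)
  (Ω : W [⋀^Fin (m + 1)]→ₗ[ℝ] ℝ)

/-- The `m`-vector `Y` on `W` associated with the section and the volume element `η`. -/
def mVector : ⋀[ℝ]^m W := exteriorPower.map m s.lift (unitMV hE η)

/-- The linear form `γ = i(Y)Ω`. -/
def gamma : Dual ℝ W := contract Ω (s.mVector hE η)

/-- The map `♭ : E* ⊗ C → (E* ⊗ H) × V*`, `h ↦ (h^H, i(i((h^V ∘ σ)ᵗ)Y)Ω |_V)`, where tensor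
products `E* ⊗ _` are written as spaces of linear maps from `E`. -/
def flat (ι : C →ₗ[ℝ] W) :
    (E →ₗ[ℝ] C) →ₗ[ℝ] (E →ₗ[ℝ] s.hor) × Dual ℝ (LinearMap.ker σ) :=
  (s.partH ι).prod ((LinearMap.ker σ).subtype.dualMap ∘ₗ contract Ω ∘ₗ
    deriv.flip (s.mVector hE η) ∘ₗ s.tildeV ι)

/-- The orthogonal complement of `C` with respect to `Ω` and the section: the annihilator of
the image of `♭` in `(E ⊗ V⁰) × V`. -/
def orthogonal (ι : C →ₗ[ℝ] W) :
    Submodule ℝ ((E ⊗[ℝ] (LinearMap.ker σ).dualAnnihilator) × LinearMap.ker σ) :=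
  (LinearMap.range (s.flat hE η Ω ι)).dualAnnihilator.comap s.pairing

end LinSection

end Splitting

/-! ## Geometry -/

section Geometry

/-- A differential `k`-form (not necessarily smooth) on a manifold modelled on `ℝ^d`. -/
abbrev Form (d k : ℕ) (N : Type*) [TopologicalSpace N]
    [ChartedSpace (EuclideanSpace ℝ (Fin d)) N] :=
  (x : N) → TangentSpace (𝓡 d) x [⋀^Fin k]→L[ℝ] ℝ

section Forms

variable {d k : ℕ} {N : Type*} [TopologicalSpace N] [ChartedSpace (EuclideanSpace ℝ (Fin d)) N]

/-- The coordinate representation of a form in the chart at `p` : its pullback by the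
inverse of the chart, a form on (the image of the chart in) `ℝ^d`. -/
def Form.inChart (α : Form d k N) (p : N) (z : EuclideanSpace ℝ (Fin d)) :
    EuclideanSpace ℝ (Fin d) [⋀^Fin k]→L[ℝ] ℝ :=
  (α ((extChartAt (𝓡 d) p).symm z)).compContinuousLinearMap
    (mfderiv 𝓘(ℝ, EuclideanSpace ℝ (Fin d)) (𝓡 d) (extChartAt (𝓡 d) p).symm z)

/-- The form is smooth: its coefficients in charts are smooth functions. -/
def Form.IsSmooth (α : Form d k N) : Prop :=
  ∀ p : N, ContDiffOn ℝ ∞ (α.inChart p) (extChartAt (𝓡 d) p).target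

/-- The form is closed: in charts its exterior derivative vanishes. -/
def Form.IsClosed (α : Form d k N) : Prop :=
  ∀ p : N, ∀ z ∈ (extChartAt (𝓡 d) p).target, extDeriv (α.inChart p) z = 0

end Forms

variable (m n : ℕ) (M F : Type*)
  [TopologicalSpace M] [ChartedSpace (EuclideanSpace ℝ (Fin m)) M]
  [TopologicalSpace F] [ChartedSpace (EuclideanSpace ℝ (Fin (m + n))) F]

/-- A fibred manifold `κ : F → M` (surjective submersion) over an `m`-dimensional manifold
with volume form `η`, and a closed `(m+1)`-form `Ω` on `F`. -/
structure System where
  κ : F → M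
  κ_smooth : ContMDiff (𝓡 (m + n)) (𝓡 m) ∞ κ
  κ_surjective : Function.Surjective κ
  κ_submersion : ∀ y, Function.Surjective (mfderiv (𝓡 (m + n)) (𝓡 m) κ y)
  η : Form m m M
  η_smooth : η.IsSmooth
  η_ne_zero : ∀ x, η x ≠ 0
  Ω : Form (m + n) (m + 1) F
  Ω_smooth : Ω.IsSmooth
  Ω_closed : Ω.IsClosed

variable {m n M F}

/-- An Ehresmann connection in `κ : F → M`: a smooth family of linear maps
`∇(y) : T_{κ(y)} M → T_y F` that are right inverse to `T_y κ`. The horizontal subspace at `y`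
is the image of `∇(y)`. -/
structure Connection [IsManifold (𝓡 m) ∞ M] [IsManifold (𝓡 (m + n)) ∞ F] (κ : F → M) where
  lift : (y : F) → TangentSpace (𝓡 m) (κ y) →L[ℝ] TangentSpace (𝓡 (m + n)) y
  comp_lift : ∀ y X, mfderiv (𝓡 (m + n)) (𝓡 m) κ y (lift y X) = X
  smooth : haveI : IsManifold (𝓡 m) 1 M := .of_le (n := ∞) (by norm_cast)
    haveI : IsManifold (𝓡 (m + n)) 1 F := .of_le (n := ∞) (by norm_cast)
    ∀ y₀ : F, ContMDiffAt (𝓡 (m + n))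
      𝓘(ℝ, EuclideanSpace ℝ (Fin m) →L[ℝ] EuclideanSpace ℝ (Fin (m + n))) ∞
      (inTangentCoordinates (𝓡 m) (𝓡 (m + n)) κ id lift y₀) y₀

instance finiteDimensional_tangentSpace (d : ℕ) (N : Type*) [TopologicalSpace N]
    [ChartedSpace (EuclideanSpace ℝ (Fin d)) N] (x : N) :
    FiniteDimensional ℝ (TangentSpace (𝓡 d) x) :=
  inferInstanceAs (FiniteDimensional ℝ (EuclideanSpace ℝ (Fin d)))

theorem finrank_tangentSpace {d : ℕ} {N : Type*} [TopologicalSpace N]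
    [ChartedSpace (EuclideanSpace ℝ (Fin d)) N] (x : N) :
    finrank ℝ (TangentSpace (𝓡 d) x) = d :=
  finrank_euclideanSpace_fin (𝕜 := ℝ) (n := d)

namespace System

variable (S : System m n M F)

/-- The tangent map `T_y κ`. -/
def tκ (y : F) : TangentSpace (𝓡 (m + n)) y →ₗ[ℝ] TangentSpace (𝓡 m) (S.κ y) :=
  (mfderiv (𝓡 (m + n)) (𝓡 m) S.κ y).toLinearMap

/-- The vertical subspace `V_y(κ)`. -/
abbrev vert (y : F) : Submodule ℝ (TangentSpace (𝓡 (m + n)) y) := LinearMap.ker (S.tκ y)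

/-- `i(Z₁) i(Z₂) i(Z₃) Ω = 0` for all vertical `Z₁, Z₂, Z₃`: the form `Ω` vanishes as soon as
three of its arguments are vertical. -/
def VanishesOnThreeVertical : Prop :=
  ∀ (y : F) (v : Fin (m + 1) → TangentSpace (𝓡 (m + n)) y) (a b c : Fin (m + 1)),
    a ≠ b → b ≠ c → a ≠ c → v a ∈ S.vert y → v b ∈ S.vert y → v c ∈ S.vert y → S.Ω y v = 0

variable [IsManifold (𝓡 m) ∞ M] [IsManifold (𝓡 (m + n)) ∞ F] (nab : Connection (m := m) (n := n) S.κ)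

/-- The connection at the point `y`, as a section of `T_y κ`. -/
def sectionAt (y : F) : LinSection (S.tκ y) where
  lift := (nab.lift y).toLinearMap
  comp_lift := nab.comp_lift y

/-- The horizontal subspace `H_y(∇)`. -/
abbrev hor (y : F) : Submodule ℝ (TangentSpace (𝓡 (m + n)) y) := (S.sectionAt nab y).hor

/-- The horizontal lift `(T_y κ |_{H_y(∇)})⁻¹ : T_{κ(y)} M → H_y(∇)`. -/
def horLift (y : F) : TangentSpace (𝓡 m) (S.κ y) →ₗ[ℝ] S.hor nab y :=
  (S.sectionAt nab y).horLift

/-- The volume element `η(κ(y))` on `T_{κ(y)} M`. -/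
def ηAt (y : F) : TangentSpace (𝓡 m) (S.κ y) [⋀^Fin m]→ₗ[ℝ] ℝ :=
  (S.η (S.κ y)).toAlternatingMap

/-- The alternating form `Ω(y)` on `T_y F`. -/
def ΩAt (y : F) : TangentSpace (𝓡 (m + n)) y [⋀^Fin (m + 1)]→ₗ[ℝ] ℝ :=
  (S.Ω y).toAlternatingMap

/-- The `m`-vector `Y(y)`, the horizontal lift of the `m`-vector dual to `η`. -/
def mVector (y : F) : ⋀[ℝ]^m (TangentSpace (𝓡 (m + n)) y) :=
  (S.sectionAt nab y).mVector (finrank_tangentSpace (S.κ y)) (S.ηAt y)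

/-- The linear form `γ(y) = i(Y(y))Ω(y)` on `T_y F`. -/
def gamma (y : F) : Dual ℝ (TangentSpace (𝓡 (m + n)) y) :=
  contract (S.ΩAt y) (S.mVector nab y)

section Submanifold

variable {k : ℕ} {C : Type*} [TopologicalSpace C] [ChartedSpace (EuclideanSpace ℝ (Fin k)) C]
  (j : C → F) (y : C)

/-- The inclusion `T_y C → T_{j(y)} F` of tangent spaces. -/
def tIncl : TangentSpace (𝓡 k) y →ₗ[ℝ] TangentSpace (𝓡 (m + n)) (j y) :=
  (mfderiv (𝓡 k) (𝓡 (m + n)) j y).toLinearMap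

/-- The horizontal part `h^H : T_{κ(y)} M → H_y(∇)` of `h : T_{κ(y)} M → T_y C`. -/
def partH (h : TangentSpace (𝓡 m) (S.κ (j y)) →ₗ[ℝ] TangentSpace (𝓡 k) y) :
    TangentSpace (𝓡 m) (S.κ (j y)) →ₗ[ℝ] S.hor nab (j y) :=
  (S.sectionAt nab (j y)).partH (tIncl j y) h

/-- The endomorphism `h^V ∘ T_y κ` of `T_y F`, for `h : T_{κ(y)} M → T_y C`. -/
def tildeV (h : TangentSpace (𝓡 m) (S.κ (j y)) →ₗ[ℝ] TangentSpace (𝓡 k) y) :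
    TangentSpace (𝓡 (m + n)) (j y) →ₗ[ℝ] TangentSpace (𝓡 (m + n)) (j y) :=
  (S.sectionAt nab (j y)).tildeV (tIncl j y) h

/-- The orthogonal complement of `T_y C` with respect to `Ω` and the connection, a subspace
of `(T_{κ(y)} M ⊗ V_y(κ)⁰) × V_y(κ)`. -/
def orthogonal : Submodule ℝ ((TangentSpace (𝓡 m) (S.κ (j y)) ⊗[ℝ]
    (S.vert (j y)).dualAnnihilator) × S.vert (j y)) :=
  (S.sectionAt nab (j y)).orthogonal (finrank_tangentSpace (S.κ (j y))) (S.ηAt (j y))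
    (S.ΩAt (j y)) (tIncl (k := k) j y)

/-- The field equations at `y ∈ C` for `h : T_{κ(y)} M → T_y C`: `h` is `κ`-transverse, and
`Ω(h(X₁), …, h(Xₘ), Y) = 0` for all `X₁, …, Xₘ ∈ T_{κ(y)} M` and `Y ∈ T_y F`. -/
def SolvesFieldEquations
    (h : TangentSpace (𝓡 m) (S.κ (j y)) →ₗ[ℝ] TangentSpace (𝓡 k) y) : Prop :=
  (∀ X, S.tκ (j y) (tIncl j y (h X)) = X) ∧
  ∀ (X : Fin m → TangentSpace (𝓡 m) (S.κ (j y))) (Y : TangentSpace (𝓡 (m + n)) (j y)),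
    S.Ω (j y) (Fin.snoc (fun i => tIncl j y (h (X i))) Y) = 0

/-- The equations for the horizontal and vertical parts of `h : T_{κ(y)} M → T_y C`:
`h^H` is the horizontal lift, and `i(i((h^V ∘ T_y κ)ᵗ)Y)Ω = -γ` on `V_y(κ)`. -/
def SolvesSplitEquations
    (h : TangentSpace (𝓡 m) (S.κ (j y)) →ₗ[ℝ] TangentSpace (𝓡 k) y) : Prop :=
  S.partH nab j y h = S.horLift nab (j y) ∧
  (contract (S.ΩAt (j y)) (deriv (S.tildeV nab j y h) (S.mVector nab (j y)))).domRestrict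
      (S.vert (j y)) =
    -(S.gamma nab (j y)).domRestrict (S.vert (j y))

end Submanifold

end System

end Geometry

end PreMultisymplectic

end

/-! Everything is linear algebra at one point. The split equations say that the pair (horizontal
lift, `-γ` on the vertical space) lies in the range of `♭`. A subspace is cut out by the functionals
vanishing on it, and by `pairing_surjective` every functional comes from the pairing, so the
annihilator condition is exactly membership in that range.

For the field equations, transversality of `h` means that `h` is the lift plus a vertical part. With
`Y` vertical, `Ω(·, …, ·, Y)` vanishes on two vertical arguments, so its value on the vectors `h bᵢ`
stops at first order in the vertical part: the zeroth term is `γ(Y)` and the linear term is the one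
in `♭`, both up to the factor `η(b)`. Testing on vertical `Y` and one basis suffices by
`field_equations_iff_basis`, since `m + 1` vectors in the `m`-dimensional image of `h` are
dependent. -/

/-! ### First-order expansion of multilinear maps -/

/-- If `f` vanishes as soon as two of its arguments lie in `V`, then a perturbation of all
arguments by vectors of `V` acts to first order only. -/
theorem MultilinearMap.map_add_eq_add_sum_update {ι W : Type*} [Fintype ι] [DecidableEq ι]
    [AddCommGroup W] [Module ℝ W] (f : MultilinearMap ℝ (fun _ : ι => W) ℝ)
    (V : Submodule ℝ W)
    (hf : ∀ (w : ι → W) (i j : ι), i ≠ j → w i ∈ V → w j ∈ V → f w = 0)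
    (a v : ι → W) (hv : ∀ i, v i ∈ V) :
    f (a + v) = f a + ∑ i, f (Function.update a i (v i)) := by
  -- With `v i ∈ V` already in slot `i`, perturbing any other slot adds only terms having two
  -- arguments in `V`.
  have one_fixed : ∀ (i : ι) (T : Finset ι), i ∉ T →
      f (Function.update (T.piecewise (a + v) a) i (v i)) = f (Function.update a i (v i)) := by
    intro i T
    induction T using Finset.induction_on with
    | empty => simp
    | insert k T hk ih =>
      intro hi
      rw [Finset.mem_insert, not_or] at hi
      rw [Finset.piecewise_insert, Function.update_comm (Ne.symm hi.1), Pi.add_apply,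
        f.map_update_add,
        hf (Function.update _ k (v k)) k i (Ne.symm hi.1) (by simpa using hv k)
          (by simpa [Function.update_of_ne hi.1] using hv i), add_zero, ← ih hi.2,
        Function.update_comm hi.1]
      congr 2
      rw [Function.update_eq_self_iff]
      simp [hk]
  have partial_sum : ∀ T : Finset ι, f (T.piecewise (a + v) a) =
      f a + ∑ i ∈ T, f (Function.update a i (v i)) := by
    intro T
    induction T using Finset.induction_on with
    | empty => simp
    | insert k T hk ih =>
      rw [Finset.piecewise_insert, Pi.add_apply, f.map_update_add, one_fixed k T hk,
        Finset.sum_insert hk,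
        (Function.update_eq_self_iff (f := T.piecewise (a + v) a)).2 (by simp [hk]), ih]
      ring
  simpa using partial_sum Finset.univ

/-! ### Duality between the range of `♭` and the orthogonal complement -/

namespace PreMultisymplectic.LinSection

variable {W E C : Type*} [AddCommGroup W] [Module ℝ W] [AddCommGroup E] [Module ℝ E]
  [AddCommGroup C] [Module ℝ C] {σ : W →ₗ[ℝ] E} (s : LinSection σ)

theorem partH_eq_horLift_iff (ι : C →ₗ[ℝ] W) (h : E →ₗ[ℝ] C) :
    s.partH ι h = s.horLift ↔ ∀ e, σ (ι (h e)) = e := by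
  rw [LinearMap.ext_iff]
  refine forall_congr' fun e => ?_
  rw [partH_apply]
  -- By definition `projH w` is `horEquiv.symm (σ w)`, so both sides are values of one injective
  -- map.
  exact s.horEquiv.symm.injective.eq_iff' rfl

/-- Expanding `g = ∑ bⁱ ⊗ g(bᵢ)` in a basis of `E` shows that `φ` is represented by `∑ bᵢ ⊗ βᵢ` with
`βᵢ(w) = φ(bⁱ ⊗ projH w)`; the projection makes `βᵢ` vanish on vertical vectors. -/
theorem pairH_surjective [FiniteDimensional ℝ E] : Function.Surjective s.pairH := by
  intro φ
  let b := finBasis ℝ E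
  let β : Fin (finrank ℝ E) → Dual ℝ W := fun i =>
    φ ∘ₗ LinearMap.smulRightₗ (b.coord i) ∘ₗ s.projH
  have hβ : ∀ i, β i ∈ (LinearMap.ker σ).dualAnnihilator := by
    intro i
    rw [Submodule.mem_dualAnnihilator]
    intro w hw
    have : s.projH w = 0 := by
      ext
      simp [projH, LinearMap.mem_ker.1 hw]
    simp [β, this]
  refine ⟨∑ i, b i ⊗ₜ ⟨β i, hβ i⟩, ?_⟩
  ext g
  have hg : ∀ x : s.hor, s.projH x = x := fun x => s.horEquiv.symm_apply_apply x
  rw [map_sum, LinearMap.sum_apply]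
  simp only [pairH_tmul, β, LinearMap.comp_apply, hg]
  rw [← map_sum]
  congr 1
  refine b.ext fun k => ?_
  simp [LinearMap.sum_apply, Finsupp.single_apply, ite_smul]

/-- A functional on the product splits into its two restrictions; the one on `V*` is evaluation at a
vector because `V` is finite-dimensional, hence reflexive. -/
theorem pairing_surjective [FiniteDimensional ℝ E] [FiniteDimensional ℝ W] :
    Function.Surjective s.pairing := by
  intro φ
  obtain ⟨t, ht⟩ := s.pairH_surjective (φ ∘ₗ LinearMap.inl ℝ _ _)
  obtain ⟨Z, hZ⟩ := (evalEquiv ℝ (LinearMap.ker σ)).surjective (φ ∘ₗ LinearMap.inr ℝ _ _)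
  refine ⟨(t, Z), LinearMap.ext fun q => ?_⟩
  have hZ' : q.2 Z = φ (0, q.2) := LinearMap.congr_fun hZ q.2
  rw [pairing_apply, ht, hZ', LinearMap.comp_apply, LinearMap.inl_apply, ← map_add]
  simp

section Forms

variable [FiniteDimensional ℝ E] {m : ℕ} (hE : finrank ℝ E = m) (η : E [⋀^Fin m]→ₗ[ℝ] ℝ)
  (Ω : W [⋀^Fin (m + 1)]→ₗ[ℝ] ℝ)

/-- The range of `♭` consists of the vectors annihilated by the orthogonal complement. -/
theorem mem_range_flat_iff [FiniteDimensional ℝ W] (ι : C →ₗ[ℝ] W)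
    (q : (E →ₗ[ℝ] s.hor) × Dual ℝ (LinearMap.ker σ)) :
    q ∈ LinearMap.range (s.flat hE η Ω ι) ↔
      ∀ p ∈ s.orthogonal hE η Ω ι, s.pairing p q = 0 := by
  rw [← Subspace.forall_mem_dualAnnihilator_apply_eq_zero_iff]
  constructor
  · exact fun H p hp => H _ hp
  · intro H φ hφ
    obtain ⟨p, rfl⟩ := s.pairing_surjective φ
    exact H p hφ

theorem exists_split_iff [FiniteDimensional ℝ W] (ι : C →ₗ[ℝ] W) :
    (∃ h : E →ₗ[ℝ] C, s.partH ι h = s.horLift ∧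
      (contract Ω (deriv (s.tildeV ι h) (s.mVector hE η))).domRestrict (LinearMap.ker σ) =
        -(s.gamma hE η Ω).domRestrict (LinearMap.ker σ)) ↔
      ∀ p ∈ s.orthogonal hE η Ω ι, s.pairH p.1 s.horLift - s.gamma hE η Ω p.2 = 0 := by
  have key := s.mem_range_flat_iff hE η Ω ι
    (s.horLift, -(s.gamma hE η Ω).domRestrict (LinearMap.ker σ))
  simp only [pairing_apply, LinearMap.neg_apply, LinearMap.domRestrict_apply,
    ← sub_eq_add_neg] at key
  rw [← key, LinearMap.mem_range]
  exact exists_congr fun h =>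
    ⟨fun H => Prod.ext H.1 H.2, fun H => ⟨congrArg Prod.fst H, congrArg Prod.snd H⟩⟩

/-! ### Split equations versus field equations -/

theorem contract_mVector (Y : W) : contract Ω (s.mVector hE η) Y =
    (η (finBasisOfFinrankEq ℝ E hE))⁻¹ *
      Ω (Fin.snoc (fun i => s.lift (finBasisOfFinrankEq ℝ E hE i)) Y) := by
  rw [mVector, unitMV, map_smul, map_smul, exteriorPower.map_apply_ιMulti, LinearMap.smul_apply,
    contract_ιMulti, smul_eq_mul]
  rfl

theorem contract_deriv_mVector (A : W →ₗ[ℝ] W) (Y : W) :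
    contract Ω (deriv A (s.mVector hE η)) Y =
      (η (finBasisOfFinrankEq ℝ E hE))⁻¹ * ∑ i,
        Ω (Fin.snoc (Function.update (fun i => s.lift (finBasisOfFinrankEq ℝ E hE i)) i
          (A (s.lift (finBasisOfFinrankEq ℝ E hE i)))) Y) := by
  rw [mVector, unitMV, map_smul, map_smul, map_smul, exteriorPower.map_apply_ιMulti,
    LinearMap.smul_apply, deriv_ιMulti, map_sum, LinearMap.sum_apply, smul_eq_mul]
  simp only [contract_ιMulti]
  rfl

/-- The field equations for a transverse `h` only need to be tested on a basis of `E` and on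
vertical vectors. -/
theorem field_equations_iff_basis (g : E →ₗ[ℝ] W) (hg : ∀ e, σ (g e) = e)
    (b : Basis (Fin m) ℝ E) :
    (∀ (X : Fin m → E) (Y : W), Ω (Fin.snoc (fun i => g (X i)) Y) = 0) ↔
      ∀ Y ∈ LinearMap.ker σ, Ω (Fin.snoc (fun i => g (b i)) Y) = 0 := by
  refine ⟨fun H Y _ => H b Y, fun H X Y => ?_⟩
  -- For fixed `Y` this is a top-degree form on `E`, so it is zero once it vanishes on the basis
  -- `b`.
  let A : W → E [⋀^Fin m]→ₗ[ℝ] ℝ := fun Y =>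
    (((contract Ω).flip Y).compAlternatingMap (exteriorPower.ιMulti ℝ m)).compLinearMap g
  have hA : ∀ Y X, A Y X = Ω (Fin.snoc (fun i => g (X i)) Y) := fun Y X => contract_ιMulti Ω _ Y
  have hvert : ∀ Y ∈ LinearMap.ker σ, A Y = 0 := fun Y hY =>
    (AlternatingMap.map_basis_eq_zero_iff b _).1 ((hA Y b).trans (H Y hY))
  have him : A (g (σ Y)) = 0 := by
    ext X
    rw [hA]
    have hdep : ¬ LinearIndependent ℝ (Fin.snoc X (σ Y) : Fin (m + 1) → E) := fun hli => by
      have := hli.fintype_card_le_finrank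
      rw [finrank_eq_card_basis b] at this
      simp at this
    have := (Ω.compLinearMap g).map_linearDependent _ hdep
    rw [AlternatingMap.compLinearMap_apply] at this
    rw [AlternatingMap.zero_apply, ← this]
    congr 1
    funext i
    refine Fin.lastCases ?_ (fun i => ?_) i <;> simp
  -- Transversality makes `Y - g (σ Y)` vertical.
  have hsplit : A Y = A (Y - g (σ Y)) + A (g (σ Y)) := by
    ext X
    simp only [A, AlternatingMap.add_apply, AlternatingMap.compLinearMap_apply,
      LinearMap.compAlternatingMap_apply, LinearMap.flip_apply]
    rw [← map_add, sub_add_cancel]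
  rw [← hA, hsplit, him, hvert _ (by simp [hg])]
  simp

/-- The equivalence holds for each `h` separately, not merely for existence: both vertical equations
are the same sum of `m + 1` terms. -/
theorem split_iff_field_equations (hη : η ≠ 0)
    (hΩ : ∀ (v : Fin (m + 1) → W) (a b c : Fin (m + 1)), a ≠ b → b ≠ c → a ≠ c →
      v a ∈ LinearMap.ker σ → v b ∈ LinearMap.ker σ → v c ∈ LinearMap.ker σ → Ω v = 0)
    (ι : C →ₗ[ℝ] W) (h : E →ₗ[ℝ] C) :
    (s.partH ι h = s.horLift ∧
      (contract Ω (deriv (s.tildeV ι h) (s.mVector hE η))).domRestrict (LinearMap.ker σ) =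
        -(s.gamma hE η Ω).domRestrict (LinearMap.ker σ)) ↔
      (∀ e, σ (ι (h e)) = e) ∧
        ∀ (X : Fin m → E) (Y : W), Ω (Fin.snoc (fun i => ι (h (X i))) Y) = 0 := by
  rw [partH_eq_horLift_iff]
  refine and_congr_right fun hσ => ?_
  have h0 : η (finBasisOfFinrankEq ℝ E hE) ≠ 0 :=
    fun h => hη ((AlternatingMap.map_basis_eq_zero_iff _ η).1 h)
  refine Iff.trans ?_ (field_equations_iff_basis Ω (ι ∘ₗ h) hσ
    (finBasisOfFinrankEq ℝ E hE)).symm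
  rw [LinearMap.ext_iff, Subtype.forall]
  refine forall₂_congr fun Y hY => ?_
  rw [LinearMap.neg_apply, LinearMap.domRestrict_apply, LinearMap.domRestrict_apply, gamma,
    contract_mVector, contract_deriv_mVector, eq_neg_iff_add_eq_zero, ← mul_add,
    mul_eq_zero_iff_left (inv_ne_zero h0), add_comm]
  -- The last argument is frozen at the vertical vector `Y`; two vertical arguments of `f` then give
  -- three of `Ω`.
  let f : MultilinearMap ℝ (fun _ : Fin m => W) ℝ :=
    (LinearMap.applyₗ Y).compMultilinearMap (Ω.toMultilinearMap.curryRight)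
  have hf : ∀ w, f w = Ω (Fin.snoc w Y) := fun w => rfl
  have hadd := f.map_add_eq_add_sum_update (LinearMap.ker σ)
    (fun w i k hik hi hk => by
      rw [hf]
      exact hΩ _ i.castSucc k.castSucc (Fin.last m) (by simpa using hik)
        (Fin.castSucc_lt_last k).ne (Fin.castSucc_lt_last i).ne
        (by simpa using hi) (by simpa using hk) (by simpa using hY))
    (fun i => s.lift (finBasisOfFinrankEq ℝ E hE i))
    (fun i => s.tildeV ι h (s.lift (finBasisOfFinrankEq ℝ E hE i)))
    (fun i => by rw [tildeV_apply]; exact Subtype.property _)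
  simp only [hf] at hadd
  rw [← hadd]
  -- Transversality identifies the horizontal part of `h bᵢ` with the lift of `bᵢ`.
  have : ((fun i => s.lift (finBasisOfFinrankEq ℝ E hE i)) +
      fun i => s.tildeV ι h (s.lift (finBasisOfFinrankEq ℝ E hE i))) =
      fun i => (ι ∘ₗ h) (finBasisOfFinrankEq ℝ E hE i) := by
    funext i
    simp [tildeV_apply, projV, s.comp_lift, hσ]
  rw [this]

end Forms

end PreMultisymplectic.LinSection

/-! ### Application to tangent spaces -/

theorem mainTheorem11 {m n k : ℕ} (hm : 1 < m) {M F C : Type*}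
    [TopologicalSpace M] [ChartedSpace (EuclideanSpace ℝ (Fin m)) M] [IsManifold (𝓡 m) ∞ M]
    [TopologicalSpace F] [ChartedSpace (EuclideanSpace ℝ (Fin (m + n))) F]
    [IsManifold (𝓡 (m + n)) ∞ F]
    [TopologicalSpace C] [ChartedSpace (EuclideanSpace ℝ (Fin k)) C] [IsManifold (𝓡 k) ∞ C]
    (S : PreMultisymplectic.System m n M F) (hΩ : S.VanishesOnThreeVertical)
    (nab : PreMultisymplectic.Connection (m := m) (n := n) S.κ)
    (j : C → F) (hj : Manifold.IsImmersion (𝓡 k) (𝓡 (m + n)) ∞ j)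
    (hj_inj : Function.Injective j) (y : C) :
    ((∃ h : TangentSpace (𝓡 m) (S.κ (j y)) →ₗ[ℝ] TangentSpace (𝓡 k) y,
        S.SolvesSplitEquations nab j y h) ↔
      ∀ p ∈ S.orthogonal (k := k) nab j y,
        (S.sectionAt nab (j y)).pairH p.1 (S.horLift nab (j y)) - S.gamma nab (j y) p.2 = 0) ∧
    ((∃ h : TangentSpace (𝓡 m) (S.κ (j y)) →ₗ[ℝ] TangentSpace (𝓡 k) y,
        S.SolvesFieldEquations j y h) ↔
      ∀ p ∈ S.orthogonal (k := k) nab j y,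
        (S.sectionAt nab (j y)).pairH p.1 (S.horLift nab (j y)) - S.gamma nab (j y) p.2 = 0) := by
  have hη : S.ηAt (j y) ≠ 0 := fun h =>
    S.η_ne_zero (S.κ (j y)) (ContinuousAlternatingMap.toAlternatingMap_injective h)
  have split_iff := (S.sectionAt nab (j y)).exists_split_iff
    (PreMultisymplectic.finrank_tangentSpace (S.κ (j y))) (S.ηAt (j y)) (S.ΩAt (j y))
    (PreMultisymplectic.System.tIncl (k := k) j y)
  refine ⟨split_iff, Iff.trans (exists_congr fun h => ?_) split_iff⟩
  exact ((S.sectionAt nab (j y)).split_iff_field_equations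
    (PreMultisymplectic.finrank_tangentSpace (S.κ (j y))) (S.ηAt (j y)) (S.ΩAt (j y)) hη (hΩ (j y))
    (PreMultisymplectic.System.tIncl (k := k) j y) h).symm
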